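/- Let $p$ be a prime, $P=\mathbb F_p[x,y]$, and let $GL_2(\mathbb F_p)$ act on $P$ by linear substitutions, with $x,y$ regarded as the standard basis of $\mathbb F_p^2$. For a subgroup $G\subseteq GL_2(\mathbb F_p)$ let $P^G$ denote the ring of invariants. Let $r$ be a positive divisor of $p-1$ and let $$L^r=\{A\in GL_2(\mathbb F_p) : \det(A^r)=1\}.$$ Put $$\delta=xy^p-x^py,\qquad d_1=\frac{xy^{p^2}-x^{p^2}y}{\delta}\in P,$$ and let $\Omega^r$ be the set of monomials $$\Omega^r=\{x^iy^j : 0\le i\le rp-1,\ 0\le j\le p^2-p+r-1\}\cup\{x^iy^j : rp\le i\le p^2-p-1,\ 0\le j\le r-1\}.$$ Then $|\Omega^r|=rp(p^2-1)=|L^r|$, the ring of invariants $P^{L^r}$ is the polynomial algebra $\mathbb F_p[d_1,\delta^r]$ (that is, $d_1$ and $\delta^r$ are algebraically independent over $\mathbb F_p$ and generate $P^{L^r}$ as an $\mathbb F_p$-algebra), and $\Omega^r$ is a basis of $P$ as a $P^{L^r}$-module. -/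

import Mathlib

open MvPolynomial

noncomputable section

namespace ReflectionInvariants

/-- The polynomial ring `P = 𝔽_p[x, y]`. -/
abbrev P (p : ℕ) : Type := MvPolynomial (Fin 2) (ZMod p)

/-- The variable `x`. -/
abbrev x (p : ℕ) : P p := X 0

/-- The variable `y`. -/
abbrev y (p : ℕ) : P p := X 1

/-- The action of a matrix `A ∈ GL₂(𝔽_p)` on `P` by linear substitution: the variables `x, y` are
the standard basis of `𝔽_p²`, so the `j`-th variable goes to the `j`-th column of `A`. -/
def act (p : ℕ) (A : GL (Fin 2) (ZMod p)) : P p →ₐ[ZMod p] P p :=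
  aeval fun j => ∑ i, C ((A : Matrix (Fin 2) (Fin 2) (ZMod p)) i j) * X i

/-- The ring of invariants `P^G`, as an `𝔽_p`-subalgebra of `P`. -/
def invariants (p : ℕ) (G : Subgroup (GL (Fin 2) (ZMod p))) : Subalgebra (ZMod p) (P p) where
  carrier := {f | ∀ A ∈ G, act p A f = f}
  mul_mem' := by
    intro f g hf hg A hA
    rw [map_mul, hf A hA, hg A hA]
  add_mem' := by
    intro f g hf hg A hA
    rw [map_add, hf A hA, hg A hA]
  algebraMap_mem' := by
    intro c A _
    exact (act p A).commutes c

/-- The group `L^r` of all `A ∈ GL₂(𝔽_p)` such that `A ^ r` has determinant `1`. -/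
def L (p r : ℕ) : Subgroup (GL (Fin 2) (ZMod p)) where
  carrier := {A | Matrix.GeneralLinearGroup.det (A ^ r) = 1}
  mul_mem' := by
    intro A B hA hB
    simp only [Set.mem_ofPred_eq, map_pow, map_mul, mul_pow] at *
    rw [hA, hB, mul_one]
  one_mem' := by simp
  inv_mem' := by
    intro A hA
    simp only [Set.mem_ofPred_eq, map_pow, map_inv, inv_pow] at *
    rw [hA, inv_one]

/-- `δ = x y^p - x^p y`. -/
def delta (p : ℕ) : P p := x p * y p ^ p - x p ^ p * y p

theorem delta_dvd (p : ℕ) [hp : Fact p.Prime] :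
    delta p ∣ x p * y p ^ (p ^ 2) - x p ^ (p ^ 2) * y p := by
  obtain ⟨k, rfl⟩ : ∃ k, p = k + 1 := ⟨p - 1, (Nat.succ_pred_eq_of_pos hp.out.pos).symm⟩
  have h := sub_dvd_pow_sub_pow (y (k + 1) ^ k) (x (k + 1) ^ k) (k + 2)
  have h1 : delta (k + 1)
      = x (k + 1) * y (k + 1) * (y (k + 1) ^ k - x (k + 1) ^ k) := by
    unfold delta
    ring
  have h2 : x (k + 1) * y (k + 1) ^ ((k + 1) ^ 2) - x (k + 1) ^ ((k + 1) ^ 2) * y (k + 1)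
      = x (k + 1) * y (k + 1) * ((y (k + 1) ^ k) ^ (k + 2) - (x (k + 1) ^ k) ^ (k + 2)) := by
    have e : (k + 1) ^ 2 = k * (k + 2) + 1 := by ring
    rw [← pow_mul, ← pow_mul, e, pow_succ, pow_succ]
    ring
  rw [h1, h2]
  exact mul_dvd_mul_left _ h

/-- `d₁ = (x y^(p²) - x^(p²) y) / δ`, the exact quotient in the domain `P`
(unique because `δ ≠ 0`). -/
def d₁ (p : ℕ) [Fact p.Prime] : P p := (delta_dvd p).choose

theorem delta_mul_d₁ (p : ℕ) [Fact p.Prime] :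
    delta p * d₁ p = x p * y p ^ (p ^ 2) - x p ^ (p ^ 2) * y p :=
  (delta_dvd p).choose_spec.symm

theorem delta_ne_zero (p : ℕ) [hp : Fact p.Prime] : delta p ≠ 0 := by
  intro h
  have h1 := congrArg (coeff (Finsupp.single 0 1 + Finsupp.single 1 p)) h
  have hne : Finsupp.single (0 : Fin 2) p + Finsupp.single 1 1
      ≠ Finsupp.single (0 : Fin 2) 1 + Finsupp.single 1 p := by
    intro e
    have e0 := DFunLike.congr_fun e 0
    simp at e0
    exact hp.out.one_lt.ne' e0
  simp only [delta, x, y, X, monomial_pow, monomial_mul, coeff_sub, coeff_monomial] at h1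
  simp [hne] at h1

/-- The set of monomials `Ω^r`, the union of two blocks: the `x^i y^j` with `0 ≤ i ≤ rp - 1` and
`0 ≤ j ≤ p² - p + r - 1`, and those with `rp ≤ i ≤ p² - p - 1` and `0 ≤ j ≤ r - 1`. -/
def Omega (p r : ℕ) : Set (P p) :=
  {m | ∃ i j : ℕ, i < r * p ∧ j < p ^ 2 - p + r ∧ m = x p ^ i * y p ^ j} ∪
  {m | ∃ i j : ℕ, r * p ≤ i ∧ i < p ^ 2 - p ∧ j < r ∧ m = x p ^ i * y p ^ j}

end ReflectionInvariants

end

namespace ReflectionInvariants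

/-! ### The linear action and its Galois theory -/

variable (p : ℕ)

/-! Let `A` be the algebra generated by `d₁` and `δ ^ r`, which are `L^r`-invariant. Three rewriting
rules, each trading a monomial outside `Ω^r` for multiples of `d₁`, `δ ^ r` and smaller monomials,
show that `Ω^r` spans `P` over `A` (`span_Omega_eq_top`). Hence `P` is finite over `A`, and
comparing transcendence degrees makes `d₁` and `δ ^ r` independent. By Artin, `P` has rank `|L^r|`
over the invariants. A count gives `|Ω^r| = |L^r|`, so the spanning set `Ω^r` is a basis over the
invariants. Coordinates in this basis already lie in `A`. As `1 ∈ Ω^r`, an invariant is its own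
coordinate at `1`, so it lies in `A`. -/

theorem act_X (A : GL (Fin 2) (ZMod p)) (j : Fin 2) :
    act p A (X j) = ∑ i, C ((A : Matrix (Fin 2) (Fin 2) (ZMod p)) i j) * X i := by
  simp [act]

theorem act_one (f : P p) : act p 1 f = f := by
  have h : act p 1 = AlgHom.id (ZMod p) (P p) := by
    ext1 j
    fin_cases j <;> simp [act_X]
  rw [h, AlgHom.id_apply]

theorem act_mul (A B : GL (Fin 2) (ZMod p)) (f : P p) :
    act p (A * B) f = act p A (act p B f) := by
  have h : act p (A * B) = (act p A).comp (act p B) := by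
    ext1 j
    simp only [act_X, AlgHom.comp_apply, map_mul, algHom_C, Matrix.mul_apply,
      Matrix.GeneralLinearGroup.coe_mul, Fin.sum_univ_two, algebraMap_eq, map_add]
    ring
  rw [h, AlgHom.comp_apply]

theorem act_injective (A B : GL (Fin 2) (ZMod p)) (h : ∀ f, act p A f = act p B f) :
    A = B := by
  ext i j
  have h1 := congrArg (coeff (Finsupp.single i 1)) (h (X j))
  rw [act_X, act_X, coeff_sum, coeff_sum] at h1
  simpa [coeff_C_mul, coeff_X, Finsupp.single_left_inj] using h1

/-- The action of `GL₂(𝔽_p)` on `P` by linear substitutions, restricted to a subgroup. -/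
@[reducible] noncomputable def actSemiring (G : Subgroup (GL (Fin 2) (ZMod p))) :
    MulSemiringAction G (P p) where
  smul A f := act p A f
  one_smul f := act_one p f
  mul_smul A B f := act_mul p A B f
  smul_zero A := map_zero (act p A)
  smul_add A := map_add (act p A)
  smul_one A := map_one (act p A)
  smul_mul A := map_mul (act p A)

theorem isGaloisGroup_invariants (G : Subgroup (GL (Fin 2) (ZMod p))) :
    letI := actSemiring p G
    IsGaloisGroup G (invariants p G) (P p) := by
  let := actSemiring p G
  refine ⟨⟨fun {A B} h => Subtype.ext (act_injective p _ _ h)⟩, ⟨fun A c f => ?_⟩,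
    ⟨fun f hf => ⟨⟨f, fun A hA => hf ⟨A, hA⟩⟩, rfl⟩⟩⟩
  change act p A ((c : P p) * f) = (c : P p) * act p A f
  rw [map_mul, c.2 A A.2]

variable [hp : Fact p.Prime]

theorem card_eq_finrank_invariants (G : Subgroup (GL (Fin 2) (ZMod p))) :
    Nat.card G = Module.finrank (invariants p G) (P p) := by
  let := actSemiring p G
  have := isGaloisGroup_invariants p G
  exact IsGaloisGroup.card_eq_finrank' G (invariants p G) (P p)

/-! ### Orders of the group and of the monomial set -/

/-- `L p r` is the preimage under the surjective determinant of the `r`-torsion of a cyclic group of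
order `p - 1`, so its index is `(p - 1) / r`. -/
theorem card_L {r : ℕ} (hr : r ∣ p - 1) : Nat.card (L p r) = r * p * (p ^ 2 - 1) := by
  have hL : L p r = (powMonoidHom r : (ZMod p)ˣ →* (ZMod p)ˣ).ker.comap
      Matrix.GeneralLinearGroup.det := by
    ext A
    change Matrix.GeneralLinearGroup.det (A ^ r) = 1 ↔ Matrix.GeneralLinearGroup.det A ^ r = 1
    rw [map_pow]
  have hdet : Function.Surjective
      (Matrix.GeneralLinearGroup.det : GL (Fin 2) (ZMod p) →* (ZMod p)ˣ) := by
    intro u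
    refine ⟨Matrix.GeneralLinearGroup.mkOfDetNeZero !![(u : ZMod p), 0; 0, 1] (by simp), ?_⟩
    ext
    simp [Matrix.GeneralLinearGroup.mkOfDetNeZero]
  have hcard := (L p r).card_mul_index
  obtain ⟨k, hk⟩ := hr
  have hp1 := hp.out.one_lt
  have hk0 : 0 < k := Nat.pos_of_ne_zero (by rintro rfl; omega)
  have hr0 : 0 < r := Nat.pos_of_ne_zero (by rintro rfl; omega)
  rw [hL, Subgroup.index_comap_of_surjective _ hdet, ← hL, IsCyclic.index_powMonoidHom_ker,
    Nat.card_eq_fintype_card (α := (ZMod p)ˣ), ZMod.card_units, hk, Nat.gcd_mul_right_left,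
    Nat.mul_div_cancel_left _ hr0, Matrix.card_GL_field] at hcard
  simp only [Fin.prod_univ_two, ZMod.card] at hcard
  have h2 : p ^ 2 - p ^ 1 = p * (r * k) := by
    rw [← hk, Nat.mul_sub, mul_one, pow_one, sq]
  refine Nat.eq_of_mul_eq_mul_right hk0 (hcard.trans ?_)
  simp only [Fin.val_zero, Fin.val_one, h2, pow_zero]
  ring

theorem card_Omega {r : ℕ} (hr : r ∣ p - 1) : (Omega p r).ncard = r * p * (p ^ 2 - 1) := by
  have hinj : Function.Injective fun a : ℕ × ℕ => x p ^ a.1 * y p ^ a.2 := by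
    intro a b h
    simp only [x, y, X, monomial_pow, monomial_mul] at h
    have h := monomial_left_injective (r := (1 : ZMod p)) one_ne_zero (by simpa using h)
    have h0 := DFunLike.congr_fun h 0
    have h1 := DFunLike.congr_fun h 1
    simp at h0 h1
    exact Prod.ext h0 h1
  have hO : Omega p r = (fun a : ℕ × ℕ => x p ^ a.1 * y p ^ a.2) ''
      (Finset.range (r * p) ×ˢ Finset.range (p ^ 2 - p + r) ∪
        Finset.Ico (r * p) (p ^ 2 - p) ×ˢ Finset.range r : Finset (ℕ × ℕ)) := by
    ext m
    simp only [Omega, Set.mem_union, Set.mem_ofPred_eq, Set.mem_image, Finset.mem_coe,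
      Finset.mem_union, Finset.mem_product, Finset.mem_range, Finset.mem_Ico, Prod.exists]
    constructor
    · rintro (⟨i, j, hi, hj, rfl⟩ | ⟨i, j, hi, hi', hj, rfl⟩)
      · exact ⟨i, j, .inl ⟨hi, hj⟩, rfl⟩
      · exact ⟨i, j, .inr ⟨⟨hi, hi'⟩, hj⟩, rfl⟩
    · rintro ⟨i, j, ⟨hi, hj⟩ | ⟨⟨hi, hi'⟩, hj⟩, rfl⟩
      · exact .inl ⟨i, j, hi, hj, rfl⟩
      · exact .inr ⟨i, j, hi, hi', hj, rfl⟩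
  rw [hO, Set.ncard_image_of_injective _ hinj, Set.ncard_coe_finset, Finset.card_union_of_disjoint]
  · simp only [Finset.card_product, Finset.card_range, Nat.card_Ico]
    have hp1 := hp.out.one_lt
    have hrp : r ≤ p - 1 := Nat.le_of_dvd (by omega) hr
    obtain ⟨q, rfl⟩ : ∃ q, p = r + q + 1 := ⟨p - 1 - r, by omega⟩
    have e1 : (r + q + 1) ^ 2 - (r + q + 1) = (r + q + 1) * (r + q) :=
      Nat.sub_eq_of_eq_add (by ring)
    have e2 : (r + q + 1) ^ 2 - 1 = (r + q + 2) * (r + q) := Nat.sub_eq_of_eq_add (by ring)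
    have e3 : (r + q + 1) * (r + q) - r * (r + q + 1) = (r + q + 1) * q :=
      Nat.sub_eq_of_eq_add (by ring)
    rw [e1, e2, e3]
    ring
  · rw [Finset.disjoint_left]
    rintro ⟨i, j⟩ h h'
    simp only [Finset.mem_product, Finset.mem_range, Finset.mem_Ico] at h h'
    omega

/-! ### Invariance of the generators -/

/-- The form is the determinant with rows `(x, y)` and their `p ^ n`-th powers; Frobenius fixes the
entries of `A`, so both rows transform by `A`. -/
theorem act_frobenius_form (A : GL (Fin 2) (ZMod p)) (n : ℕ) :
    act p A (x p * y p ^ (p ^ n) - x p ^ (p ^ n) * y p) =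
      C (A : Matrix (Fin 2) (Fin 2) (ZMod p)).det *
        (x p * y p ^ (p ^ n) - x p ^ (p ^ n) * y p) := by
  simp only [map_sub, map_mul, map_pow, act_X, Fin.sum_univ_two, add_pow_char_pow, mul_pow,
    ← C_pow, ZMod.pow_card_pow, Matrix.det_fin_two]
  ring

theorem act_delta (A : GL (Fin 2) (ZMod p)) :
    act p A (delta p) = C (A : Matrix (Fin 2) (Fin 2) (ZMod p)).det * delta p := by
  simpa [delta] using act_frobenius_form p A 1

theorem d₁_mem_invariants (G : Subgroup (GL (Fin 2) (ZMod p))) : d₁ p ∈ invariants p G := by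
  intro A _
  have h := congrArg (act p A) (delta_mul_d₁ p)
  rw [act_frobenius_form, map_mul, act_delta, ← delta_mul_d₁, mul_assoc] at h
  have hdet : (C (A : Matrix (Fin 2) (Fin 2) (ZMod p)).det : P p) ≠ 0 := by
    rw [Ne, C_eq_zero]
    exact A.det_ne_zero
  exact mul_left_cancel₀ (delta_ne_zero p) (mul_left_cancel₀ hdet h)

theorem delta_pow_mem_invariants (r : ℕ) : delta p ^ r ∈ invariants p (L p r) := by
  intro A hA
  have h : (A : Matrix (Fin 2) (Fin 2) (ZMod p)).det ^ r = 1 := by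
    have h := congrArg Units.val (show Matrix.GeneralLinearGroup.det (A ^ r) = 1 from hA)
    simpa using h
  rw [map_pow, act_delta, mul_pow, ← C_pow, h, C_1, one_mul]

/-! ### Identities behind the rewriting rules -/

theorem delta_eq : delta p = x p * y p * (y p ^ (p - 1) - x p ^ (p - 1)) := by
  obtain ⟨k, hk⟩ : ∃ k, p = k + 1 := ⟨p - 1, (Nat.succ_pred_eq_of_pos hp.out.pos).symm⟩
  have h : p - 1 = k := by omega
  have e (z : P p) : z ^ p = z ^ k * z := by
    rw [← pow_succ, ← hk]
  rw [delta, e, e, h]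
  ring

theorem delta_mul_d₁' :
    delta p * d₁ p =
      x p * y p * ((y p ^ (p - 1)) ^ (p + 1) - (x p ^ (p - 1)) ^ (p + 1)) := by
  have hp1 := hp.out.one_lt
  have e : p ^ 2 = (p - 1) * (p + 1) + 1 := by
    obtain ⟨k, rfl⟩ : ∃ k, p = k + 1 := ⟨p - 1, by omega⟩
    simp only [Nat.add_sub_cancel]
    ring
  rw [delta_mul_d₁, e, pow_succ, pow_succ, pow_mul, pow_mul]
  ring

theorem d₁_eq_sum : d₁ p = ∑ k ∈ Finset.range (p + 1),
    (x p ^ (p - 1)) ^ k * (y p ^ (p - 1)) ^ (p - k) := by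
  refine mul_left_cancel₀ (delta_ne_zero p) ?_
  have h := geom_sum₂_mul (x p ^ (p - 1)) (y p ^ (p - 1)) (p + 1)
  simp only [Nat.add_sub_cancel] at h
  rw [delta_mul_d₁', delta_eq]
  linear_combination (x p * y p) * h

/-- With `X = x ^ (p - 1)` and `Y = y ^ (p - 1)`, divide `Y ^ (p + 1) - X ^ (p + 1) = Y ^ p * (Y -
X) + X * (Y - X) ^ p` by `Y - X`. -/
theorem d₁_eq_add : d₁ p =
    x p ^ (p - 1) * (y p ^ (p - 1) - x p ^ (p - 1)) ^ (p - 1) + (y p ^ (p - 1)) ^ p := by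
  refine mul_left_cancel₀ (delta_ne_zero p) ?_
  have h := sub_pow_char (p := p) (y p ^ (p - 1)) (x p ^ (p - 1))
  rw [← pow_sub_one_mul hp.out.ne_zero (y p ^ (p - 1) - _)] at h
  rw [delta_mul_d₁', delta_eq]
  linear_combination (- x p * y p * x p ^ (p - 1)) * h

/-- The elimination of `x` between `d₁` and `δ ^ r`. -/
theorem y_pow_eq {r : ℕ} (hr : r ≤ p - 1) : y p ^ (p ^ 2 - p + r) =
    d₁ p * y p ^ r - delta p ^ r *
      (x p ^ (p - 1 - r) * (y p ^ (p - 1) - x p ^ (p - 1)) ^ (p - 1 - r)) := by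
  obtain ⟨q, hq⟩ := Nat.exists_eq_add_of_le hr
  have e : p ^ 2 - p = (p - 1) * p := by rw [Nat.sub_mul, sq, one_mul]
  have e' : p - 1 - r = q := by omega
  rw [d₁_eq_add, delta_eq, e, e', pow_add, pow_mul]
  have e1 : (y p ^ (p - 1) - x p ^ (p - 1)) ^ (p - 1) =
    (y p ^ (p - 1) - x p ^ (p - 1)) ^ r * (y p ^ (p - 1) - x p ^ (p - 1)) ^ q := by
    rw [← pow_add, ← hq]
  have e2 : x p ^ (p - 1) = x p ^ r * x p ^ q := by rw [← pow_add, ← hq]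
  rw [e1, mul_pow, mul_pow]
  linear_combination (-y p ^ r * (y p ^ (p - 1) - x p ^ (p - 1)) ^ r
    * (y p ^ (p - 1) - x p ^ (p - 1)) ^ q) * e2

theorem x_pow_eq : x p ^ (p ^ 2 - p) = d₁ p - ∑ k ∈ Finset.range p,
    x p ^ ((p - 1) * k) * y p ^ ((p - 1) * (p - k)) := by
  have e : p ^ 2 - p = (p - 1) * p := by rw [Nat.sub_mul, sq, one_mul]
  rw [d₁_eq_sum, Finset.sum_range_succ, e]
  simp [pow_mul]

theorem sub_pow_eq_sum {R : Type*} [CommRing R] (a b : R) (n : ℕ) :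
    (b - a) ^ n = ∑ k ∈ Finset.range (n + 1),
      ((-1) ^ k * n.choose k : ℤ) • (a ^ k * b ^ (n - k)) := by
  rw [sub_eq_neg_add, add_pow]
  refine Finset.sum_congr rfl fun k _ => ?_
  rw [zsmul_eq_mul, neg_pow]
  push_cast
  ring

theorem delta_pow_eq_sum (r : ℕ) : delta p ^ r = ∑ k ∈ Finset.range (r + 1),
    ((-1) ^ k * r.choose k : ℤ) • (x p ^ (r + (p - 1) * k) * y p ^ (r + (p - 1) * (r - k))) := by
  rw [delta_eq, mul_pow, sub_pow_eq_sum, Finset.mul_sum]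
  refine Finset.sum_congr rfl fun k _ => ?_
  rw [mul_smul_comm, pow_add, pow_add, pow_mul, pow_mul]
  congr 1
  ring

/-- The leading term of `δ ^ r` with respect to `x`. -/
theorem x_pow_mul_y_pow_eq (r : ℕ) : x p ^ (r * p) * y p ^ r = (-1) ^ r * delta p ^ r -
    ∑ k ∈ Finset.range r, ((-1) ^ r * ((-1) ^ k * r.choose k) : ℤ) •
      (x p ^ (r + (p - 1) * k) * y p ^ (r + (p - 1) * (r - k))) := by
  have e : r * p = r + (p - 1) * r := by
    obtain ⟨k, hk⟩ : ∃ k, p = k + 1 := ⟨p - 1, (Nat.succ_pred_eq_of_pos hp.out.pos).symm⟩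
    rw [hk, Nat.add_sub_cancel]
    ring
  rw [delta_pow_eq_sum, Finset.sum_range_succ, mul_add, Finset.mul_sum, e]
  have h : ((-1) ^ r * (-1) ^ r : P p) = 1 := by rw [← mul_pow]; simp
  simp only [zsmul_eq_mul, Nat.choose_self, Nat.sub_self, Nat.cast_one, mul_one, mul_zero,
    add_zero]
  push_cast
  simp only [mul_assoc]
  linear_combination (-(x p ^ (r + (p - 1) * r) * y p ^ r)) * h

/-! ### Spanning over the generated subalgebra -/

variable (r : ℕ)

/-- The subalgebra generated by `d₁` and `δ ^ r`. -/
noncomputable abbrev generated : Subalgebra (ZMod p) (P p) :=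
  Algebra.adjoin (ZMod p) {d₁ p, delta p ^ r}

variable {p r} in
theorem generated_mul_mem_span {a f : P p} (ha : a ∈ generated p r)
    (hf : f ∈ Submodule.span (generated p r) (Omega p r)) :
    a * f ∈ Submodule.span (generated p r) (Omega p r) :=
  Submodule.smul_mem _ (⟨a, ha⟩ : generated p r) hf

theorem monomial_mem_span (hr0 : 0 < r) (hr : r ≤ p - 1) (i j : ℕ) :
    x p ^ i * y p ^ j ∈ Submodule.span (generated p r) (Omega p r) := by
  obtain ⟨n, hn⟩ : ∃ n, n = i + j := ⟨_, rfl⟩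
  -- Order monomials by total degree, then by the exponent of `x`. Multiples of `d₁` and `δ ^ r`
  -- drop the degree; the remaining terms of the two `x`-rules keep it and lower the exponent of
  -- `x`.
  induction n using Nat.strong_induction_on generalizing i j with
  | _ n ihn =>
  induction i using Nat.strong_induction_on generalizing j with
  | _ i ihi =>
  have hp1 := hp.out.one_lt
  have hd : d₁ p ∈ generated p r := Algebra.subset_adjoin (by simp)
  have hδ : delta p ^ r ∈ generated p r := Algebra.subset_adjoin (by simp)
  have hpp : p ^ 2 - p = (p - 1) * p := by rw [Nat.sub_mul, sq, one_mul]
  have hpos : 0 < (p - 1) * p := Nat.mul_pos (by omega) (by omega)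
  by_cases hi : p ^ 2 - p ≤ i
  · obtain ⟨i', rfl⟩ := Nat.exists_eq_add_of_le hi
    have e : x p ^ (p ^ 2 - p + i') * y p ^ j = d₁ p * (x p ^ i' * y p ^ j) -
        ∑ k ∈ Finset.range p,
          x p ^ ((p - 1) * k + i') * y p ^ ((p - 1) * (p - k) + j) := by
      rw [pow_add, x_pow_eq, sub_mul, sub_mul, Finset.sum_mul, Finset.sum_mul, mul_assoc]
      congr 1
      refine Finset.sum_congr rfl fun k _ => ?_
      ring
    rw [e]
    refine Submodule.sub_mem _ (generated_mul_mem_span hd (ihn _ ?_ _ _ rfl))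
      (Submodule.sum_mem _ fun k hk => ihi _ ?_ _ ?_)
    · omega
    · have := Nat.mul_lt_mul_of_pos_left (Finset.mem_range.1 hk) (show 0 < p - 1 by omega)
      omega
    · have : (p - 1) * k + (p - 1) * (p - k) = (p - 1) * p := by
        rw [← mul_add, Nat.add_sub_cancel' (Finset.mem_range.1 hk).le]
      omega
  by_cases hi' : r * p ≤ i
  · by_cases hj : r ≤ j
    · obtain ⟨i', rfl⟩ := Nat.exists_eq_add_of_le hi'
      obtain ⟨j', rfl⟩ := Nat.exists_eq_add_of_le hj
      have e : x p ^ (r * p + i') * y p ^ (r + j') =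
          ((-1) ^ r * delta p ^ r) * (x p ^ i' * y p ^ j') -
          ∑ k ∈ Finset.range r, ((-1) ^ r * ((-1) ^ k * r.choose k) : ℤ) •
            (x p ^ (r + (p - 1) * k + i') * y p ^ (r + (p - 1) * (r - k) + j')) := by
        have e1 : x p ^ (r * p + i') * y p ^ (r + j') =
            (x p ^ (r * p) * y p ^ r) * (x p ^ i' * y p ^ j') := by ring
        rw [e1, x_pow_mul_y_pow_eq, sub_mul, Finset.sum_mul]
        congr 1
        refine Finset.sum_congr rfl fun k _ => ?_
        rw [smul_mul_assoc]
        congr 1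
        ring
      have hrp : r * p = r + (p - 1) * r := by
        obtain ⟨k, hk⟩ : ∃ k, p = k + 1 := ⟨p - 1, by omega⟩
        rw [hk, Nat.add_sub_cancel]
        ring
      have hrpos : 0 < r * p := Nat.mul_pos hr0 (by omega)
      rw [e]
      refine Submodule.sub_mem _ (generated_mul_mem_span
        (mul_mem (pow_mem (neg_mem (one_mem _)) _) hδ) (ihn _ ?_ _ _ rfl))
        (Submodule.sum_mem _ fun k hk => zsmul_mem (ihi _ ?_ _ ?_) _)
      · omega
      · have := Nat.mul_lt_mul_of_pos_left (Finset.mem_range.1 hk) (show 0 < p - 1 by omega)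
        omega
      · have : (p - 1) * k + (p - 1) * (r - k) = (p - 1) * r := by
          rw [← mul_add, Nat.add_sub_cancel' (Finset.mem_range.1 hk).le]
        omega
    · exact Submodule.subset_span (.inr ⟨i, j, hi', by omega, by omega, rfl⟩)
  · by_cases hj : p ^ 2 - p + r ≤ j
    · obtain ⟨j', rfl⟩ := Nat.exists_eq_add_of_le hj
      have e : x p ^ i * y p ^ (p ^ 2 - p + r + j') = d₁ p * (x p ^ i * y p ^ (r + j')) -
          delta p ^ r * ∑ k ∈ Finset.range (p - 1 - r + 1),
            ((-1) ^ k * (p - 1 - r).choose k : ℤ) •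
            (x p ^ (i + (p - 1 - r) + (p - 1) * k) *
              y p ^ (j' + (p - 1) * (p - 1 - r - k))) := by
        have e1 : ∑ k ∈ Finset.range (p - 1 - r + 1),
            ((-1) ^ k * (p - 1 - r).choose k : ℤ) •
            (x p ^ (i + (p - 1 - r) + (p - 1) * k) *
              y p ^ (j' + (p - 1) * (p - 1 - r - k))) =
            (x p ^ (p - 1 - r) * (y p ^ (p - 1) - x p ^ (p - 1)) ^ (p - 1 - r)) *
              (x p ^ i * y p ^ j') := by
          rw [sub_pow_eq_sum, Finset.mul_sum, Finset.sum_mul]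
          refine Finset.sum_congr rfl fun k _ => ?_
          rw [mul_smul_comm, smul_mul_assoc, ← pow_mul, ← pow_mul]
          congr 1
          ring
        rw [e1, pow_add, y_pow_eq p hr]
        ring
      rw [e]
      refine Submodule.sub_mem _ (generated_mul_mem_span hd (ihn _ ?_ _ _ rfl))
        (generated_mul_mem_span hδ (Submodule.sum_mem _ fun k hk =>
          zsmul_mem (ihn _ ?_ _ _ rfl) _))
      · omega
      -- The total degree falls by `r * (p + 1)`, the degree of `δ ^ r`. The exponent of `x` may
      -- grow, so only the outer induction applies.
      · have h1 : (p - 1) * k + (p - 1) * (p - 1 - r - k) = (p - 1) * (p - 1 - r) := by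
          rw [← mul_add, Nat.add_sub_cancel' (by have := Finset.mem_range.1 hk; omega)]
        have h2 : (p - 1) * (p - 1 - r) + (p - 1) * (r + 1) = (p - 1) * p := by
          rw [← mul_add]; congr 1; omega
        rw [mul_add, mul_one] at h2
        have h5 : r ≤ (p - 1) * r := Nat.le_mul_of_pos_left _ (by omega)
        omega
    · exact Submodule.subset_span (.inl ⟨i, j, by omega, by omega, rfl⟩)

variable {r}

theorem span_Omega_eq_top (hr0 : 0 < r) (hr : r ≤ p - 1) :
    Submodule.span (generated p r) (Omega p r) = ⊤ := by
  refine eq_top_iff.2 fun f _ => ?_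
  induction f using MvPolynomial.induction_on' with
  | add f g hf hg => exact add_mem (hf trivial) (hg trivial)
  | monomial u c =>
    have e : monomial u c = C c * (x p ^ u 0 * y p ^ u 1) := by
      rw [monomial_eq, Finsupp.prod_fintype _ _ (fun _ => pow_zero _), Fin.prod_univ_two]
    rw [e]
    exact generated_mul_mem_span (algebraMap_mem (generated p r) c)
      (monomial_mem_span p r hr0 hr _ _)

/-! ### Independence, freeness and the ring of invariants -/

theorem Omega_finite (hr0 : 0 < r) (hr : r ∣ p - 1) : (Omega p r).Finite := by
  refine Set.finite_of_ncard_pos ?_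
  rw [card_Omega p hr]
  have hp1 := hp.out.one_lt
  have := Nat.one_lt_pow two_ne_zero hp1
  exact Nat.mul_pos (Nat.mul_pos hr0 (by omega)) (by omega)

theorem algebraicIndependent_d₁_delta_pow (hr0 : 0 < r) (hr : r ∣ p - 1) :
    AlgebraicIndependent (ZMod p) ![d₁ p, delta p ^ r] := by
  have hrange : Set.range ![d₁ p, delta p ^ r] = {d₁ p, delta p ^ r} := by simp [Set.pair_comm]
  have hfin : Module.Finite (generated p r) (P p) :=
    ⟨Submodule.fg_def.2 ⟨_, Omega_finite p hr0 hr, span_Omega_eq_top p hr0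
      (Nat.le_of_dvd (Nat.sub_pos_of_lt hp.out.one_lt) hr)⟩⟩
  have halg : Algebra.IsAlgebraic
      (Algebra.adjoin (ZMod p) (Set.range ![d₁ p, delta p ^ r])) (P p) := by
    rw [hrange]
    infer_instance
  -- Two elements over which `P`, of transcendence degree 2, is algebraic must be independent.
  refine (Algebra.IsAlgebraic.isTranscendenceBasis_of_le_trdeg_of_finite (ZMod p) _ ?_).1
  rw [MvPolynomial.trdeg_of_isDomain]
  simp

theorem generated_le_invariants : generated p r ≤ invariants p (L p r) :=
  Algebra.adjoin_le <| by
    rintro _ (rfl | rfl)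
    · exact d₁_mem_invariants p _
    · exact delta_pow_mem_invariants p r

theorem span_invariants_Omega (hr0 : 0 < r) (hr : r ≤ p - 1) :
    Submodule.span (invariants p (L p r)) (Omega p r) = ⊤ := by
  refine eq_top_iff.2 fun f _ => ?_
  have hf : f ∈ Submodule.span (generated p r) (Omega p r) := by
    rw [span_Omega_eq_top p hr0 hr]; trivial
  induction hf using Submodule.span_induction with
  | mem f hf => exact Submodule.subset_span hf
  | zero => exact zero_mem _
  | add f g _ _ hf hg => exact add_mem (hf trivial) (hg trivial)
  | smul a f _ hf =>
    exact Submodule.smul_mem _ (⟨a, generated_le_invariants p a.2⟩ : invariants p (L p r))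
      (hf trivial)

theorem exists_basis_Omega (hr0 : 0 < r) (hr : r ∣ p - 1) :
    ∃ b : Module.Basis (Omega p r) (invariants p (L p r)) (P p),
      ∀ m : Omega p r, b m = (m : P p) := by
  have := (Omega_finite p hr0 hr).fintype
  have hspan : ⊤ ≤ Submodule.span (invariants p (L p r))
      (Set.range (Subtype.val : Omega p r → P p)) := by
    rw [Subtype.range_coe, span_invariants_Omega p hr0
      (Nat.le_of_dvd (Nat.sub_pos_of_lt hp.out.one_lt) hr)]
  have hcard : Fintype.card (Omega p r) = Module.finrank (invariants p (L p r)) (P p) := by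
    rw [← card_eq_finrank_invariants, card_L p hr, ← card_Omega p hr,
      ← Nat.card_eq_fintype_card, Nat.card_coe_set_eq]
  exact ⟨basisOfTopLeSpanOfCardEqFinrank _ hspan hcard, fun m => by simp⟩

theorem one_mem_Omega (hr0 : 0 < r) : 1 ∈ Omega p r :=
  .inl ⟨0, 0, Nat.mul_pos hr0 hp.out.pos, by omega, by simp⟩

theorem invariants_L_eq (hr0 : 0 < r) (hr : r ∣ p - 1) :
    invariants p (L p r) = generated p r := by
  refine le_antisymm (fun f hf => ?_) (generated_le_invariants p)
  obtain ⟨b, hb⟩ := exists_basis_Omega p hr0 hr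
  -- An expansion over `generated p r` is also one over the invariants, so by uniqueness it gives
  -- the coordinates in `b`.
  have key (g : P p) (m : Omega p r) : (b.repr g m : P p) ∈ generated p r := by
    have hg : g ∈ Submodule.span (generated p r) (Omega p r) := by
      rw [span_Omega_eq_top p hr0 (Nat.le_of_dvd (Nat.sub_pos_of_lt hp.out.one_lt) hr)]; trivial
    induction hg using Submodule.span_induction with
    | mem g hg =>
      rw [show g = b ⟨g, hg⟩ from (hb ⟨g, hg⟩).symm, b.repr_self, Finsupp.single_apply]
      split_ifs
      · exact one_mem _
      · exact zero_mem _
    | zero => simp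
    | add g h _ _ hg hh => simpa using add_mem hg hh
    | smul a g _ hg =>
      have e : a • g = (⟨a, generated_le_invariants p a.2⟩ : invariants p (L p r)) • g := rfl
      rw [e, map_smul]
      exact mul_mem a.2 hg
  have h := key f ⟨1, one_mem_Omega p hr0⟩
  have e : f = (⟨f, hf⟩ : invariants p (L p r)) • b ⟨1, one_mem_Omega p hr0⟩ := by
    rw [hb]
    exact (mul_one f).symm
  rw [e, map_smul, b.repr_self] at h
  simpa using h

end ReflectionInvariants

theorem mainTheorem7 (p : ℕ) [Fact p.Prime] (r : ℕ) (hr : r ∣ p - 1) :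
    -- `|Ω^r| = r p (p² - 1) = |L^r|`
    (ReflectionInvariants.Omega p r).ncard = r * p * (p ^ 2 - 1) ∧
    Nat.card (ReflectionInvariants.L p r) = r * p * (p ^ 2 - 1) ∧
    -- `P^{L^r}` is the polynomial algebra `𝔽_p[d₁, δ^r]`
    ReflectionInvariants.invariants p (ReflectionInvariants.L p r) =
      Algebra.adjoin (ZMod p) {ReflectionInvariants.d₁ p, ReflectionInvariants.delta p ^ r} ∧
    AlgebraicIndependent (ZMod p)
      ![ReflectionInvariants.d₁ p, ReflectionInvariants.delta p ^ r] ∧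
    -- the elements of `Ω^r` form a basis of `P` over `P^{L^r}`
    ∃ b : Module.Basis (ReflectionInvariants.Omega p r)
        (ReflectionInvariants.invariants p (ReflectionInvariants.L p r))
        (ReflectionInvariants.P p),
      ∀ m : ReflectionInvariants.Omega p r, b m = (m : ReflectionInvariants.P p) := by
  have hr0 : 0 < r := Nat.pos_of_dvd_of_pos hr (Nat.sub_pos_of_lt (Fact.out : p.Prime).one_lt)
  exact ⟨ReflectionInvariants.card_Omega p hr, ReflectionInvariants.card_L p hr,
    ReflectionInvariants.invariants_L_eq p hr0 hr,
    ReflectionInvariants.algebraicIndependent_d₁_delta_pow p hr0 hr,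
    ReflectionInvariants.exists_basis_Omega p hr0 hr⟩
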